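/- **Setting.** Let $d\ge 1$ and let $\psi:[0,\lambda_{\max})\to[0,\infty)$, $\lambda_{\max}\in(0,\infty]$, be twice continuously differentiable and strictly convex with $\psi(0)=\psi'(0)=0$, $\psi''(0)>0$ and $\sup\psi'=\infty$, and such that $\lambda\mapsto\psi(\lambda)/\lambda^2$ is nondecreasing on $(0,\lambda_{\max})$. Let $\psi^*(u)=\sup_{\lambda\in[0,\lambda_{\max})}(u\lambda-\psi(\lambda))$ for $u\ge0$, with inverse function $(\psi^*)^{-1}:[0,\infty)\to[0,\infty)$. Let $(\mathcal F_t)_{t\ge0}$ be a filtration on a probability space, $\theta^*\in\mathbb R^d$ a fixed vector, $(X_t)_{t\ge1}$ an $\mathbb R^d$-valued predictable process ($X_t$ is $\mathcal F_{t-1}$-measurable), $(\epsilon_t)_{t\ge1}$ a real-valued adapted process, and $Y_t=\langle X_t,\theta^*\rangle+\epsilon_t$. Put $S_t=\sum_{s=1}^t\epsilon_sX_s$ and $V_t=\sum_{s=1}^tX_sX_s^\top$. Assume that $(S_t)$ is sub-$\psi$ with variance proxy $(V_t)$: for every unit vector $\nu\in\mathbb R^d$ and every $\lambda\in[0,\lambda_{\max})$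 there is a nonnegative supermartingale $(L^{\lambda\nu}_t)_{t\ge0}$ with respect to $(\mathcal F_t)$ such that $\mathbb E[L^{\lambda\nu}_0]\le1$ and, almost surely, $$\exp\{\lambda\langle\nu,S_t\rangle-\psi(\lambda)\langle\nu,V_t\nu\rangle\}\le L^{\lambda\nu}_t\quad\text{for all }t\ge0.$$ For a symmetric matrix $V$ let $\gamma_{\min}(V)$ and $\gamma_{\max}(V)$ be its smallest and largest eigenvalues, $\kappa(V)=\gamma_{\max}(V)/\gamma_{\min}(V)$, and let $V\vee\rho I_d$ be obtained from $V$ by replacing each eigenvalue $\gamma$ by $\max(\gamma,\rho)$ and keeping the eigenvectors. Let $N_{d-1}(r)$ be the least number of points of the unit sphere $\mathbb S^{d-1}\subset\mathbb R^d$ such that every point of the sphere is within Euclidean distance $r$ of one of them. Let $\alpha>1$, $\beta>1$, $\rho>0$, $\epsilon\in(0,1)$, $\delta\in(0,1)$ be constants, and let $h:[0,\infty)\to(0,\infty)$ be nondecreasing with $\sum_{k=0}^\infty h(k)^{-1}\le1$. Define $$L_\rho(V)=\log h\!\left(\log_\alpha\frac{\gamma_{\max}(V\vee\rho I_d)}{\rho}\right)+\log\frac{1}{\delta(1-\beta^{-1})}+\log\!\left(\beta\sqrt{\kappa(V\vee\rho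 I_d)}\;N_{d-1}\!\left(\frac{\epsilon}{\beta\sqrt{\kappa(V\vee\rho I_d)}}\right)\right),$$ and let $$\hat\theta_t=(\mathbf X_t^\top\mathbf X_t\vee\rho I_d)^{-1}\mathbf X_t^\top\mathbf Y_t$$ be the least-squares estimate with shrinkage, where $\mathbf X_t$ has rows $X_1,\dots,X_t$ and $\mathbf Y_t=(Y_1,\dots,Y_t)^\top$. (Thus $\hat\theta_t$ is the ordinary least-squares estimate whenever $V_t\succeq\rho I_d$.) **Corollary 5.1.** Then $$\mathbb P\left(\exists t\ge0:\ \big\|V_t^{1/2}(\hat\theta_t-\theta^*)\big\|\ge\frac{\sqrt{\gamma_{\min}(V_t)}}{1-\epsilon}\,(\psi^*)^{-1}\!\left(\frac{\alpha}{\gamma_{\min}(V_t)}L_\rho(V_t)\right)\ \text{and}\ V_t\succeq\rho I_d\right)\le\delta .$$ In particular the radius does not involve $\|\theta^*\|$. -/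

import Mathlib

open MeasureTheory
open scoped ENNReal NNReal

namespace OnlineReg

noncomputable section

/-- Euclidean space `ℝ^d`. -/
abbrev Vec (d : ℕ) : Type := EuclideanSpace ℝ (Fin d)

/-- Real `d × d` matrices. -/
abbrev Mat (d : ℕ) : Type := Matrix (Fin d) (Fin d) ℝ

/-! ### CGF-like functions -/

/-- The interval `[0, lamMax)`, where `lamMax` may be `∞`. -/
def dom (lamMax : EReal) : Set ℝ := {l : ℝ | 0 ≤ l ∧ (l : EReal) < lamMax}

/-- `ψ : [0, lamMax) → [0, ∞)` is CGF-like: twice continuously differentiable (one-sidedly at `0`),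
strictly convex, `ψ 0 = ψ' 0 = 0` and `ψ'' 0 > 0`. Values of `ψ` off the interval are irrelevant. -/
structure IsCGFLike (lamMax : EReal) (ψ : ℝ → ℝ) : Prop where
  lamMax_pos : 0 < lamMax
  nonneg : ∀ l ∈ dom lamMax, 0 ≤ ψ l
  contDiffOn : ContDiffOn ℝ 2 ψ (dom lamMax)
  strictConvexOn : StrictConvexOn ℝ (dom lamMax) ψ
  map_zero : ψ 0 = 0
  deriv_zero : derivWithin ψ (dom lamMax) 0 = 0
  deriv2_zero : 0 < derivWithin (derivWithin ψ (dom lamMax)) (dom lamMax) 0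

/-- `ψ` is super-Gaussian: `ψ l / l ^ 2` is nondecreasing in `l ∈ (0, lamMax)`. -/
def IsSuperGaussian (lamMax : EReal) (ψ : ℝ → ℝ) : Prop :=
  MonotoneOn (fun l => ψ l / l ^ 2) (dom lamMax ∩ Set.Ioi 0)

/-- `sup ψ' = ∞` over `[0, lamMax)`. -/
def HasUnboundedDeriv (lamMax : EReal) (ψ : ℝ → ℝ) : Prop :=
  ¬ BddAbove (derivWithin ψ (dom lamMax) '' dom lamMax)

/-- The convex conjugate `ψ* u = sup { u * l - ψ l | l ∈ [0, lamMax) }`. -/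
def convexConj (lamMax : EReal) (ψ : ℝ → ℝ) (u : ℝ) : ℝ :=
  sSup ((fun l => u * l - ψ l) '' dom lamMax)

/-- The inverse function `(ψ*)⁻¹` of `ψ* : [0, ∞) → [0, ∞)`: for `x ≥ 0` it is
the `u ≥ 0` with `ψ* u = x`. -/
def convexConjInv (lamMax : EReal) (ψ : ℝ → ℝ) (x : ℝ) : ℝ :=
  Function.invFunOn (convexConj lamMax ψ) (Set.Ici 0) x

/-! ### Spectral notation for symmetric matrices -/

/-- The largest eigenvalue of a symmetric matrix. -/
def gammaMax {d : ℕ} (V : Mat d) : ℝ := sSup (spectrum ℝ V)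

/-- The smallest eigenvalue of a symmetric matrix. -/
def gammaMin {d : ℕ} (V : Mat d) : ℝ := sInf (spectrum ℝ V)

/-- The condition number. -/
def kappa {d : ℕ} (V : Mat d) : ℝ := gammaMax V / gammaMin V

/-- `V ∨ ρ I`: each eigenvalue `γ` of the symmetric matrix `V` is replaced by `max γ ρ`
(functional calculus), with the eigenvectors kept. -/
def clip {d : ℕ} (V : Mat d) (ρ : ℝ) : Mat d := cfc (fun x : ℝ => max x ρ) V

/-- The positive semidefinite square root `V ^ (1/2)` (functional calculus). -/
def sqrtMat {d : ℕ} (V : Mat d) : Mat d := cfc Real.sqrt V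

/-! ### Covering numbers of the sphere -/

/-- `N_{d-1}(r)`: the least cardinality of a proper `r`-covering of the unit sphere of `ℝ^d`
(finite for `r > 0`). -/
def sphereCov (d : ℕ) (r : ℝ) : ℕ :=
  (Metric.coveringNumber r.toNNReal (Metric.sphere (0 : Vec d) 1)).toNat

/-- The covering number in `sphereCov` is finite, so that `toNat` loses nothing. -/
theorem coveringNumber_sphere_ne_top (d : ℕ) {r : ℝ} (hr : 0 < r) :
    Metric.coveringNumber r.toNNReal (Metric.sphere (0 : Vec d) 1) ≠ ⊤ := by
  obtain ⟨N, hN, hfin, hcov⟩ := Metric.exists_finite_isCover_of_isCompact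
    (Real.toNNReal_pos.2 hr).ne' (isCompact_sphere (0 : Vec d) 1)
  exact ne_top_of_le_ne_top (Set.encard_ne_top_iff.2 hfin)
    (Metric.IsCover.coveringNumber_le_encard hN hcov)

/-! ### Sub-`ψ` processes -/

variable {Ω : Type*} {mΩ : MeasurableSpace Ω}

/-- A scalar process `S` is sub-`ψ` with variance proxy `V ≥ 0` (with respect to the filtration
`ℱ`): for each `l ∈ [0, lamMax)` the process `exp (l * S_t - ψ l * V_t)` is almost surely
dominated by a nonnegative supermartingale `L` started from `E L₀ ≤ 1`. -/
structure IsSubPsiScalar (μ : Measure Ω) (ℱ : Filtration ℕ mΩ) (lamMax : EReal) (ψ : ℝ → ℝ)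
    (S V : ℕ → Ω → ℝ) : Prop where
  adapted_S : StronglyAdapted ℱ S
  adapted_V : StronglyAdapted ℱ V
  nonneg_V : ∀ t ω, 0 ≤ V t ω
  exists_supermartingale : ∀ l ∈ dom lamMax, ∃ L : ℕ → Ω → ℝ,
    Supermartingale L ℱ μ ∧ (∀ᵐ ω ∂μ, ∀ t, 0 ≤ L t ω) ∧ ∫ ω, L 0 ω ∂μ ≤ 1 ∧
      ∀ᵐ ω ∂μ, ∀ t, Real.exp (l * S t ω - ψ l * V t ω) ≤ L t ω

/-- An `ℝ^d`-valued process `S` is sub-`ψ` with positive semidefinite matrix variance proxy `V`: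
in each direction `ν` of the unit sphere, `(⟨ν, S_t⟩, ⟨ν, V_t ν⟩)` is sub-`ψ`. -/
structure IsSubPsi {d : ℕ} (μ : Measure Ω) (ℱ : Filtration ℕ mΩ) (lamMax : EReal) (ψ : ℝ → ℝ)
    (S : ℕ → Ω → Vec d) (V : ℕ → Ω → Mat d) : Prop where
  adapted_S : StronglyAdapted ℱ S
  adapted_V : StronglyAdapted ℱ V
  posSemidef_V : ∀ t ω, (V t ω).PosSemidef
  subPsi_proj : ∀ ν : Vec d, ‖ν‖ = 1 →
    IsSubPsiScalar μ ℱ lamMax ψ (fun t ω => inner ℝ ν (S t ω))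
      (fun t ω => inner ℝ ν (Matrix.toEuclideanLin (V t ω) ν))

/-! ### Online linear regression -/

/-- The residual process `S_t = ∑_{s=1}^t ε_s X_s`. -/
def residual {d : ℕ} (X : ℕ → Ω → Vec d) (noise : ℕ → Ω → ℝ) (t : ℕ) (ω : Ω) : Vec d :=
  ∑ s ∈ Finset.Icc 1 t, noise s ω • X s ω

/-- The covariance process `V_t = ∑_{s=1}^t X_s X_sᵀ`. -/
def covariance {d : ℕ} (X : ℕ → Ω → Vec d) (t : ℕ) (ω : Ω) : Mat d :=
  ∑ s ∈ Finset.Icc 1 t, Matrix.vecMulVec (X s ω).ofLp (X s ω).ofLp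

/-- The online linear regression model with slope `θ`, indexed by rounds `t ≥ 1` (the values at
index `0` of `X`, `noise`, `Y` play no role): `X` is predictable, `noise` is adapted,
`Y_t = ⟨X_t, θ⟩ + noise_t`, and the residual process is sub-`ψ` with variance proxy the
covariance process. -/
structure IsOnlineLinReg {d : ℕ} (μ : Measure Ω) (ℱ : Filtration ℕ mΩ) (lamMax : EReal)
    (ψ : ℝ → ℝ) (θ : Vec d) (X : ℕ → Ω → Vec d) (noise Y : ℕ → Ω → ℝ) : Prop where
  predictable_X : ∀ t, Measurable[ℱ t] (X (t + 1))
  adapted_noise : ∀ t, 1 ≤ t → Measurable[ℱ t] (noise t)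
  response : ∀ t, 1 ≤ t → ∀ ω, Y t ω = inner ℝ (X t ω) θ + noise t ω
  subPsi : IsSubPsi μ ℱ lamMax ψ (residual X noise) (covariance X)

/-- The design matrix, with rows `X_1, …, X_t`. -/
def designMatrix {d : ℕ} (X : ℕ → Ω → Vec d) (t : ℕ) (ω : Ω) : Matrix (Fin t) (Fin d) ℝ :=
  Matrix.of fun i j => X (i + 1) ω j

/-- The vector of responses `(Y_1, …, Y_t)`. -/
def responseVec (Y : ℕ → Ω → ℝ) (t : ℕ) (ω : Ω) : Fin t → ℝ := fun i => Y (i + 1) ω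

/-- The least squares estimate with shrinkage, `(XᵀX ∨ ρ I)⁻¹ Xᵀ Y`. -/
def thetaHat {d : ℕ} (ρ : ℝ) (X : ℕ → Ω → Vec d) (Y : ℕ → Ω → ℝ) (t : ℕ) (ω : Ω) : Vec d :=
  WithLp.toLp 2 (Matrix.mulVec
    (clip ((designMatrix X t ω).transpose * designMatrix X t ω) ρ)⁻¹
    (Matrix.mulVec (designMatrix X t ω).transpose (responseVec Y t ω)))

/-- `V_t` is also `XᵀX` for the design matrix `X` at time `t`. -/
theorem designMatrix_transpose_mul_self {d : ℕ} (X : ℕ → Ω → Vec d) (t : ℕ) (ω : Ω) :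
    (designMatrix X t ω).transpose * designMatrix X t ω = covariance X t ω := by
  ext i j
  simp only [Matrix.mul_apply, covariance, Matrix.sum_apply, Matrix.vecMulVec_apply,
    Matrix.transpose_apply, designMatrix, Matrix.of_apply]
  rw [Fin.sum_univ_eq_sum_range (fun k => X (k + 1) ω i * X (k + 1) ω j),
    ← Finset.Ico_add_one_right_eq_Icc, Finset.sum_Ico_eq_sum_range]
  simp [add_comm]

/-! ### The boundary -/

/-- The function `L_ρ(V)`. -/
def boundaryLog {d : ℕ} (α β ρ ε δ : ℝ) (h : ℝ → ℝ) (V : Mat d) : ℝ :=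
  Real.log (h (Real.logb α (gammaMax (clip V ρ) / ρ)))
    + Real.log (1 / δ * (1 / (1 - β⁻¹)))
    + Real.log (β * √(kappa (clip V ρ)) * sphereCov d (ε / (β * √(kappa (clip V ρ)))))

/-- The radius `√γ_min(V) / (1 - ε) * (ψ*)⁻¹ (α / γ_min(V) * L_ρ(V))`. -/
def radius {d : ℕ} (lamMax : EReal) (ψ : ℝ → ℝ) (α β ρ ε δ : ℝ) (h : ℝ → ℝ) (V : Mat d) : ℝ :=
  √(gammaMin V) / (1 - ε) *
    convexConjInv lamMax ψ (α / gammaMin V * boundaryLog α β ρ ε δ h V)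

end

end OnlineReg

namespace OnlineReg

noncomputable section

/-! ### The convex conjugate and its inverse -/

section Conjugate

variable {lamMax : EReal} {ψ : ℝ → ℝ}

/-! Write `z` for the estimation error and `S`, `V` for the residual and covariance. Once `V ≥ ρ I`,
shrinkage does nothing and the normal equations give `V z = S`. Hence `⟨w, S⟩` is the inner product
of `V^{1/2} w` and `V^{1/2} z`, and a lower bound on `‖V^{1/2} z‖` becomes a crossing by a scalar
sub-`ψ` process, provided `V^{1/2} w` is nearly parallel to `V^{1/2} z`.

Such a `w` comes from a finite cover of the sphere. Applying `V^{1/2}` magnifies relative errors by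
at most `√κ(V)`, so if `√κ < β ^ (j + 1)` a cover of radius `ε / β ^ (j + 1)` has a point whose
image makes an angle of cosine at least `1 - ε` (`exists_mem_cover_inner_ge`). The random quadratic
form `W = ⟨w, V w⟩` is located in a shell `[ρ α ^ k, ρ α ^ (k + 1))`. In cell `(k, j)` a
deterministic `l` is tuned to the lower end of the shell, so Ville's inequality bounds the
probability of each crossing by the inverse of `peelLevel`. The levels are chosen so that the union
over `k`, `j` and cover points costs at most `δ` (`tsum_peelLevel_inv_le`).

The deterministic core is `exists_peelLevel_le_exp`. The natural threshold involves `√W (ψ*)⁻¹(α L /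
W)`. Super-Gaussianity makes this nonincreasing in `W`, so `W` may be replaced by `γ_min(V)`, which
gives the stated radius. -/

theorem zero_mem_dom (hpos : 0 < lamMax) : (0 : ℝ) ∈ dom lamMax :=
  ⟨le_rfl, by simpa using hpos⟩

theorem mem_dom_of_le {l m : ℝ} (hm : m ∈ dom lamMax) (hl : 0 ≤ l) (hlm : l ≤ m) :
    l ∈ dom lamMax :=
  ⟨hl, lt_of_le_of_lt (EReal.coe_le_coe_iff.2 hlm) hm.2⟩

theorem exists_pos_mem_dom (hpos : 0 < lamMax) : ∃ b : ℝ, 0 < b ∧ b ∈ dom lamMax := by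
  obtain ⟨b, hb0, hb⟩ := EReal.lt_iff_exists_real_btwn.1 hpos
  have : (0 : ℝ) < b := by exact_mod_cast hb0
  exact ⟨b, this, this.le, hb⟩

theorem IsCGFLike.convex_dom (hψ : IsCGFLike lamMax ψ) : Convex ℝ (dom lamMax) :=
  hψ.strictConvexOn.1

theorem IsCGFLike.uniqueDiffOn_dom (hψ : IsCGFLike lamMax ψ) : UniqueDiffOn ℝ (dom lamMax) := by
  obtain ⟨b, hb0, hb⟩ := exists_pos_mem_dom hψ.lamMax_pos
  refine uniqueDiffOn_convex hψ.convex_dom ⟨b / 2, ?_⟩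
  refine interior_mono (s := Set.Icc 0 b) (fun l hl => mem_dom_of_le hb hl.1 hl.2) ?_
  rw [interior_Icc]
  constructor <;> linarith

theorem IsCGFLike.differentiableOn (hψ : IsCGFLike lamMax ψ) :
    DifferentiableOn ℝ ψ (dom lamMax) :=
  hψ.contDiffOn.differentiableOn (by norm_num)

theorem IsCGFLike.continuousOn_derivWithin (hψ : IsCGFLike lamMax ψ) :
    ContinuousOn (derivWithin ψ (dom lamMax)) (dom lamMax) :=
  hψ.contDiffOn.continuousOn_derivWithin hψ.uniqueDiffOn_dom (by norm_num)

/-- The graph of `ψ` lies above its tangents. -/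
theorem IsCGFLike.tangent_le (hψ : IsCGFLike lamMax ψ) {a l : ℝ} (ha : a ∈ dom lamMax)
    (hl : l ∈ dom lamMax) : ψ a + derivWithin ψ (dom lamMax) a * (l - a) ≤ ψ l := by
  have hd := hψ.differentiableOn a ha
  rcases lt_trichotomy a l with h | rfl | h
  · have := hψ.strictConvexOn.convexOn.derivWithin_le_slope ha hl h hd
    rw [slope_def_field, le_div_iff₀ (sub_pos.2 h)] at this
    linarith
  · simp
  · have := hψ.strictConvexOn.convexOn.slope_le_derivWithin hl ha h hd
    rw [slope_def_field, div_le_iff₀ (sub_pos.2 h)] at this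
    linarith

/-- Every positive value is attained by the Legendre transform `l * ψ' l - ψ l`. -/
theorem IsCGFLike.exists_legendre_eq (hψ : IsCGFLike lamMax ψ)
    (hd : HasUnboundedDeriv lamMax ψ) {x : ℝ} (hx : 0 < x) :
    ∃ l ∈ dom lamMax, 0 < l ∧ derivWithin ψ (dom lamMax) l * l = x + ψ l := by
  obtain ⟨b, hb0, hb⟩ := exists_pos_mem_dom hψ.lamMax_pos
  have h0 := zero_mem_dom hψ.lamMax_pos
  set D := derivWithin ψ (dom lamMax) with hD
  -- The tangent at `m`, evaluated at `b`, gives `D m * m - ψ m ≥ D m * b - ψ b`; a slope above `(x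
  -- + ψ b) / b` makes this exceed `x`. At `0` the transform vanishes, so continuity gives the value
  -- `x` in between.
  obtain ⟨_, ⟨m, hm, rfl⟩, hmx⟩ := not_bddAbove_iff.1 hd ((x + ψ b) / b)
  have hgm : x ≤ D m * m - ψ m := by
    have h1 := hψ.tangent_le hm hb
    rw [div_lt_iff₀ hb0] at hmx
    linarith
  have hcont : ContinuousOn (fun l => D l * l - ψ l) (dom lamMax) :=
    (hψ.continuousOn_derivWithin.mul continuousOn_id).sub hψ.contDiffOn.continuousOn
  obtain ⟨l, hl, hlx⟩ := hψ.convex_dom.isPreconnected.intermediate_value h0 hm hcont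
    (show x ∈ Set.Icc _ _ from ⟨by simp [hψ.map_zero, hx.le], hgm⟩)
  simp only at hlx
  refine ⟨l, hl, lt_of_le_of_ne hl.1 ?_, by linarith⟩
  rintro rfl
  simp [hψ.map_zero] at hlx
  linarith

/-- For `x > 0`, the number `u = (ψ*)⁻¹ x` is the minimum of `(x + ψ l) / l` over `l > 0`. -/
theorem IsCGFLike.convexConjInv_spec (hψ : IsCGFLike lamMax ψ)
    (hd : HasUnboundedDeriv lamMax ψ) {x : ℝ} (hx : 0 < x) :
    (∃ l ∈ dom lamMax, 0 < l ∧ convexConjInv lamMax ψ x * l = x + ψ l) ∧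
      ∀ l ∈ dom lamMax, convexConjInv lamMax ψ x * l ≤ x + ψ l := by
  obtain ⟨l, hl, hl0, hlx⟩ := hψ.exists_legendre_eq hd hx
  set u := derivWithin ψ (dom lamMax) l with hu
  have hmin : ∀ m ∈ dom lamMax, u * m ≤ x + ψ m := fun m hm => by
    have := hψ.tangent_le hl hm
    rw [← hu] at this
    linarith
  have hu0 : 0 ≤ u := by
    by_contra! h
    nlinarith [hψ.nonneg l hl]
  have hgreat : IsGreatest ((fun m => u * m - ψ m) '' dom lamMax) x :=
    ⟨⟨l, hl, by simp only; linarith⟩, by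
      rintro _ ⟨m, hm, rfl⟩
      have := hmin m hm
      simp only
      linarith⟩
  -- Since `x` is attained, `invFunOn` returns a genuine preimage `v`; what remains is uniqueness,
  -- `v = u`.
  have hex : ∃ v ∈ Set.Ici (0 : ℝ), convexConj lamMax ψ v = x := ⟨u, hu0, hgreat.csSup_eq⟩
  have hv0 : 0 ≤ convexConjInv lamMax ψ x := Function.invFunOn_mem hex
  have hvx : convexConj lamMax ψ (convexConjInv lamMax ψ x) = x := Function.invFunOn_eq hex
  suffices h : convexConjInv lamMax ψ x = u by
    rw [h]
    exact ⟨⟨l, hl, hl0, hlx⟩, hmin⟩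
  set v := convexConjInv lamMax ψ x with hv
  -- An unbounded set would have real supremum `0` by convention, contradicting `x > 0`.
  have hbdd : BddAbove ((fun m => v * m - ψ m) '' dom lamMax) := by
    by_contra h
    rw [convexConj, Real.sSup_of_not_bddAbove h] at hvx
    exact hx.ne hvx
  have hle : ∀ m ∈ dom lamMax, v * m - ψ m ≤ x := fun m hm =>
    hvx ▸ le_csSup hbdd ⟨m, hm, rfl⟩
  refine le_antisymm (le_of_mul_le_mul_right ?_ hl0) ?_
  · linarith [hle l hl]
  by_contra! hvu
  -- If `v < u`, then `v * m - ψ m` stays uniformly below `x`: up to `η` it is at most `x / 2`, and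
  -- beyond `η` it loses at least `(u - v) * η` against `u * m - ψ m ≤ x`. So the supremum could not
  -- equal `x`.
  set η := x / (2 * (v + 1)) with hη
  have hη0 : 0 < η := by positivity
  have hηv : v * η ≤ x / 2 := by
    rw [hη, mul_div_assoc', div_le_div_iff₀ (by positivity) (by norm_num)]
    nlinarith
  have hsup : convexConj lamMax ψ v ≤ max (x / 2) (x - (u - v) * η) := by
    refine csSup_le ⟨_, l, hl, rfl⟩ ?_
    rintro _ ⟨m, hm, rfl⟩
    simp only
    rcases le_total m η with h | h
    · refine le_max_of_le_left ?_
      have := mul_le_mul_of_nonneg_left h hv0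
      linarith [hψ.nonneg m hm]
    · refine le_max_of_le_right ?_
      have := mul_le_mul_of_nonneg_left h (sub_pos.2 hvu).le
      linarith [hmin m hm]
  rw [hvx] at hsup
  rcases le_max_iff.1 hsup with h | h
  · linarith
  · linarith [mul_pos (sub_pos.2 hvu) hη0]

/-- A minimum over `l` of the functions `(x + ψ l) / l`, each increasing in `x`, is monotone; the
minimiser for `y` serves as test point for `x`. -/
theorem IsCGFLike.convexConjInv_mono (hψ : IsCGFLike lamMax ψ)
    (hd : HasUnboundedDeriv lamMax ψ) {x y : ℝ} (hx : 0 < x) (hxy : x ≤ y) :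
    convexConjInv lamMax ψ x ≤ convexConjInv lamMax ψ y := by
  obtain ⟨l, hl, hl0, hly⟩ := (hψ.convexConjInv_spec hd (hx.trans_le hxy)).1
  have := (hψ.convexConjInv_spec hd hx).2 l hl
  exact le_of_mul_le_mul_right (by linarith) hl0

/-- For a super-Gaussian `ψ`, the function `w ↦ √w * (ψ*)⁻¹ (c / w)` is nonincreasing. -/
theorem IsCGFLike.sqrt_mul_convexConjInv_anti (hψ : IsCGFLike lamMax ψ)
    (hs : IsSuperGaussian lamMax ψ) (hd : HasUnboundedDeriv lamMax ψ) {c v w : ℝ}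
    (hc : 0 < c) (hv : 0 < v) (hvw : v ≤ w) :
    √w * convexConjInv lamMax ψ (c / w) ≤ √v * convexConjInv lamMax ψ (c / v) := by
  have hw : 0 < w := hv.trans_le hvw
  obtain ⟨l, hl, hl0, hlx⟩ := (hψ.convexConjInv_spec hd (div_pos hc hv)).1
  -- The minimiser `l` for `c / v`, shrunk by `r`, is tested in the problem for `c / w`:
  -- super-Gaussianity gives `ψ (r * l) ≤ r ^ 2 * ψ l`, and `c / w` also scales by `r ^ 2`.
  set r := √v / √w with hr
  have hsv : 0 < √v := Real.sqrt_pos.2 hv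
  have hsw : 0 < √w := Real.sqrt_pos.2 hw
  have hr0 : 0 < r := div_pos hsv hsw
  have hr1 : r ≤ 1 := (div_le_one hsw).2 (Real.sqrt_le_sqrt hvw)
  have hr2 : r ^ 2 = v / w := by rw [hr, div_pow, Real.sq_sqrt hv.le, Real.sq_sqrt hw.le]
  have hrl : r * l ≤ l := mul_le_of_le_one_left hl0.le hr1
  have hmem : r * l ∈ dom lamMax := mem_dom_of_le hl (by positivity) hrl
  have hψr : ψ (r * l) ≤ r ^ 2 * ψ l := by
    have := hs ⟨hmem, mul_pos hr0 hl0⟩ ⟨hl, hl0⟩ hrl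
    simp only at this
    rw [div_le_div_iff₀ (by positivity) (by positivity), mul_pow] at this
    refine le_of_mul_le_mul_right ?_ (show 0 < l ^ 2 by positivity)
    linarith
  have hmin := (hψ.convexConjInv_spec hd (div_pos hc hw)).2 _ hmem
  have hcw : c / w = r ^ 2 * (c / v) := by rw [hr2]; field_simp
  have key : convexConjInv lamMax ψ (c / w) * (r * l)
      ≤ r * (r * l) * convexConjInv lamMax ψ (c / v) := by
    calc _ ≤ _ := hmin
      _ ≤ r ^ 2 * (c / v + ψ l) := by rw [mul_add, ← hcw]; linarith
      _ = _ := by rw [← hlx]; ring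
  have key' : convexConjInv lamMax ψ (c / w) ≤ r * convexConjInv lamMax ψ (c / v) :=
    le_of_mul_le_mul_right (by linarith) (mul_pos hr0 hl0)
  calc _ ≤ √w * (r * convexConjInv lamMax ψ (c / v)) := by gcongr
    _ = _ := by rw [hr]; field_simp

end Conjugate

/-! ### Ville's inequality -/

section Ville

variable {Ω : Type*} {mΩ : MeasurableSpace Ω} {μ : Measure Ω} {ℱ : Filtration ℕ mΩ}

/-- The event that `L` has reached the level `c` by time `n`. -/
def reachedBy (L : ℕ → Ω → ℝ) (c : ℝ) (n : ℕ) : Set Ω := {ω | ∃ t ≤ n, c ≤ L t ω}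

theorem measurableSet_reachedBy {L : ℕ → Ω → ℝ} (hL : StronglyAdapted ℱ L) (c : ℝ) (n : ℕ) :
    MeasurableSet[ℱ n] (reachedBy L c n) := by
  have : reachedBy L c n = ⋃ t ∈ Set.Iic n, {ω | c ≤ L t ω} := by
    ext ω; simp [reachedBy]
  rw [this]
  refine MeasurableSet.biUnion (Set.to_countable _) fun t ht => ?_
  exact ℱ.mono ht _ ((hL t).measurable measurableSet_Ici)

/-- The process stopped on reaching the level `c` has mean at most the initial mean. -/
theorem setIntegral_compl_reachedBy_add_le [IsFiniteMeasure μ] {L : ℕ → Ω → ℝ}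
    (hL : Supermartingale L ℱ μ) {c : ℝ} (n : ℕ) :
    ∫ ω in (reachedBy L c n)ᶜ, L n ω ∂μ + c * μ.real (reachedBy L c n) ≤ ∫ ω, L 0 ω ∂μ := by
  have hm : ∀ n, MeasurableSet (reachedBy L c n) := fun n =>
    ℱ.le n _ (measurableSet_reachedBy hL.1 c n)
  have hlevel : ∀ {s : Set Ω} (n : ℕ), MeasurableSet s → (∀ ω ∈ s, c ≤ L n ω) →
      c * μ.real s ≤ ∫ ω in s, L n ω ∂μ := fun {s} n hs h => by
    have := setIntegral_mono_on (μ := μ) (s := s) (f := fun _ => c) (g := L n)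
      (integrable_const c).integrableOn (hL.integrable n).integrableOn hs h
    rwa [setIntegral_const, smul_eq_mul, mul_comm] at this
  induction n with
  | zero =>
    rw [← integral_add_compl (hm 0) (hL.integrable 0), add_comm]
    gcongr
    refine hlevel 0 (hm 0) ?_
    rintro ω ⟨t, ht, h⟩
    rwa [Nat.le_zero.1 ht] at h
  | succ n ih =>
    refine le_trans ?_ ih
    set A := reachedBy L c n with hA
    set B := reachedBy L c (n + 1) with hB
    have hAB : A ⊆ B := fun ω ⟨t, ht, h⟩ => ⟨t, ht.trans n.le_succ, h⟩
    -- The supermartingale property is used on `Aᶜ`, an event known at time `n`; on `B \ A`, where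
    -- `c` is first reached at time `n + 1`, the integral is then bounded below by the mass times
    -- `c`.
    have h1 : ∫ ω in Aᶜ, L (n + 1) ω ∂μ ≤ ∫ ω in Aᶜ, L n ω ∂μ :=
      hL.setIntegral_le n.le_succ (measurableSet_reachedBy hL.1 c n).compl
    have h2 : ∫ ω in Aᶜ, L (n + 1) ω ∂μ
        = ∫ ω in B \ A, L (n + 1) ω ∂μ + ∫ ω in Bᶜ, L (n + 1) ω ∂μ := by
      rw [← setIntegral_union _ (hm _).compl (hL.integrable _).integrableOn
        (hL.integrable _).integrableOn]
      · congr 2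
        ext ω
        have := @hAB ω
        simp only [Set.mem_compl_iff, Set.mem_union, Set.mem_sdiff]
        tauto
      · exact Set.disjoint_left.2 fun ω h h' => h' h.1
    have h3 : c * μ.real (B \ A) ≤ ∫ ω in B \ A, L (n + 1) ω ∂μ := by
      refine hlevel (n + 1) ((hm _).diff (hm _)) ?_
      rintro ω ⟨⟨t, ht, h⟩, hn⟩
      rcases Nat.le_succ_iff.1 ht with h' | rfl
      · exact absurd ⟨t, h', h⟩ hn
      · exact h
    have h4 : μ.real B = μ.real (B \ A) + μ.real A := by
      rw [measureReal_sdiff hAB (hm n)]; ring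
    rw [h4]
    linarith

/-- **Ville's inequality** for almost surely nonnegative supermartingales. -/
theorem measure_exists_le_of_supermartingale [IsFiniteMeasure μ] {L : ℕ → Ω → ℝ}
    (hL : Supermartingale L ℱ μ) (hnonneg : ∀ᵐ ω ∂μ, ∀ t, 0 ≤ L t ω)
    (hinit : ∫ ω, L 0 ω ∂μ ≤ 1) {c : ℝ} (hc : 0 < c) :
    μ {ω | ∃ t, c ≤ L t ω} ≤ ENNReal.ofReal c⁻¹ := by
  have hU : {ω | ∃ t, c ≤ L t ω} = ⋃ n, reachedBy L c n := by
    ext ω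
    simp only [reachedBy, Set.mem_ofPred_eq, Set.mem_iUnion]
    exact ⟨fun ⟨t, h⟩ => ⟨t, t, le_rfl, h⟩, fun ⟨_, t, _, h⟩ => ⟨t, h⟩⟩
  have hmono : Monotone (reachedBy L c) := fun m n hmn ω ⟨t, ht, h⟩ => ⟨t, ht.trans hmn, h⟩
  rw [hU, hmono.measure_iUnion]
  refine iSup_le fun n => ?_
  rw [← ofReal_measureReal]
  refine ENNReal.ofReal_le_ofReal ?_
  have h1 := setIntegral_compl_reachedBy_add_le hL (c := c) n
  have h2 : 0 ≤ ∫ ω in (reachedBy L c n)ᶜ, L n ω ∂μ :=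
    integral_nonneg_of_ae (ae_restrict_of_ae (hnonneg.mono fun ω h => h n))
  rw [inv_eq_one_div, le_div_iff₀ hc]
  linarith

end Ville

/-! ### Quadratic forms and square roots of positive semidefinite matrices -/

section MatrixFacts

variable {d : ℕ} {V : Mat d}

open scoped MatrixOrder in
theorem gammaMin_smul_one_le (hV : V.PosSemidef) : (V - gammaMin V • (1 : Mat d)).PosSemidef := by
  rw [← Algebra.algebraMap_eq_smul_one, ← Matrix.le_iff]
  exact algebraMap_le_of_le_spectrum
    (fun x hx => csInf_le Matrix.finite_real_spectrum.bddBelow hx) hV.1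

open scoped MatrixOrder in
theorem le_gammaMax_smul_one (hV : V.PosSemidef) : (gammaMax V • (1 : Mat d) - V).PosSemidef := by
  rw [← Algebra.algebraMap_eq_smul_one, ← Matrix.le_iff]
  exact le_algebraMap_of_spectrum_le
    (fun x hx => le_csSup Matrix.finite_real_spectrum.bddAbove hx) hV.1

theorem inner_toEuclideanLin_nonneg (hV : V.PosSemidef) (x : Vec d) :
    0 ≤ inner ℝ x (Matrix.toEuclideanLin V x) :=
  (Matrix.isPositive_toEuclideanLin_iff.2 hV).inner_nonneg_right x

theorem gammaMin_mul_norm_sq_le (hV : V.PosSemidef) (x : Vec d) :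
    gammaMin V * ‖x‖ ^ 2 ≤ inner ℝ x (Matrix.toEuclideanLin V x) := by
  have := inner_toEuclideanLin_nonneg (gammaMin_smul_one_le hV) x
  simp only [map_sub, map_smul, Matrix.toLpLin_one, LinearMap.sub_apply, LinearMap.smul_apply,
    LinearMap.id_apply, inner_sub_right, inner_smul_right, real_inner_self_eq_norm_sq] at this
  linarith

theorem inner_le_gammaMax_mul_norm_sq (hV : V.PosSemidef) (x : Vec d) :
    inner ℝ x (Matrix.toEuclideanLin V x) ≤ gammaMax V * ‖x‖ ^ 2 := by
  have := inner_toEuclideanLin_nonneg (le_gammaMax_smul_one hV) x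
  simp only [map_sub, map_smul, Matrix.toLpLin_one, LinearMap.sub_apply, LinearMap.smul_apply,
    LinearMap.id_apply, inner_sub_right, inner_smul_right, real_inner_self_eq_norm_sq] at this
  linarith

open scoped MatrixOrder in
theorem le_of_mem_spectrum (hV : V.PosSemidef) {ρ : ℝ}
    (hρ : (V - ρ • (1 : Mat d)).PosSemidef) {x : ℝ} (hx : x ∈ spectrum ℝ V) : ρ ≤ x := by
  rw [← Algebra.algebraMap_eq_smul_one, ← Matrix.le_iff] at hρ
  exact (algebraMap_le_iff_le_spectrum (p := IsSelfAdjoint) hV.1).1 hρ x hx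

theorem clip_eq_self (hV : V.PosSemidef) {ρ : ℝ} (hρ : (V - ρ • (1 : Mat d)).PosSemidef) :
    clip V ρ = V := by
  exact (cfc_congr (g := id) fun x hx => max_eq_left (le_of_mem_spectrum hV hρ hx)).trans
    (cfc_id ℝ V hV.1)

/-- Positive dimension makes the spectrum nonempty, without which `sInf` would default to `0`. -/
theorem le_gammaMin (hd : 1 ≤ d) (hV : V.PosSemidef) {ρ : ℝ}
    (hρ : (V - ρ • (1 : Mat d)).PosSemidef) : ρ ≤ gammaMin V :=
  le_csInf ⟨_, hV.1.eigenvalues_mem_spectrum_real ⟨0, hd⟩⟩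
    fun _ hx => le_of_mem_spectrum hV hρ hx

theorem sqrtMat_mul_self (hV : V.PosSemidef) : sqrtMat V * sqrtMat V = V := by
  have h0 : ∀ x ∈ spectrum ℝ V, 0 ≤ x := fun x hx =>
    le_of_mem_spectrum hV (ρ := 0) (by simpa using hV) hx
  rw [sqrtMat, ← cfc_mul Real.sqrt Real.sqrt V (by fun_prop) (by fun_prop)]
  exact (cfc_congr (g := id) fun x hx => Real.mul_self_sqrt (h0 x hx)).trans (cfc_id ℝ V hV.1)

theorem sqrtMat_sqrtMat_apply (hV : V.PosSemidef) (x : Vec d) :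
    Matrix.toEuclideanLin (sqrtMat V) (Matrix.toEuclideanLin (sqrtMat V) x)
      = Matrix.toEuclideanLin V x := by
  conv_rhs => rw [← sqrtMat_mul_self hV]
  simp [Matrix.toLpLin_apply, Matrix.mulVec_mulVec]

theorem inner_sqrtMat_sqrtMat (hV : V.PosSemidef) (x y : Vec d) :
    inner ℝ (Matrix.toEuclideanLin (sqrtMat V) x) (Matrix.toEuclideanLin (sqrtMat V) y)
      = inner ℝ x (Matrix.toEuclideanLin V y) := by
  have hR : (sqrtMat V).IsHermitian := cfc_predicate (p := IsSelfAdjoint) Real.sqrt V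
  rw [← sqrtMat_sqrtMat_apply hV y]
  exact Matrix.isSymmetric_toEuclideanLin_iff.2 hR _ _

theorem norm_sqrtMat_sq (hV : V.PosSemidef) (x : Vec d) :
    ‖Matrix.toEuclideanLin (sqrtMat V) x‖ ^ 2 = inner ℝ x (Matrix.toEuclideanLin V x) := by
  rw [← real_inner_self_eq_norm_sq, inner_sqrtMat_sqrtMat hV]

theorem isUnit_det_of_sub_smul_one {ρ : ℝ} (hρ0 : 0 < ρ)
    (hρ : (V - ρ • (1 : Mat d)).PosSemidef) : IsUnit V.det := by
  have : V.PosDef := by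
    have h1 : (ρ • (1 : Mat d)).PosDef := Matrix.PosDef.one.smul hρ0
    simpa using h1.add_posSemidef hρ
  exact this.det_pos.ne'.isUnit

end MatrixFacts

/-! ### Covering directions and angles under a linear map -/

section Angle

variable {E : Type*} [NormedAddCommGroup E] [InnerProductSpace ℝ E]

/-- If `a` is within `ε * ‖b‖` of `b`, the cosine of the angle between `a` and `b` is at least
`1 - ε`. -/
theorem one_sub_mul_norm_mul_norm_le_inner {a b : E} {ε : ℝ} (hε0 : 0 ≤ ε) (hε1 : ε ≤ 1)
    (h : ‖a - b‖ ≤ ε * ‖b‖) : (1 - ε) * (‖a‖ * ‖b‖) ≤ inner ℝ a b := by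
  have h2 : ‖a - b‖ ^ 2 ≤ (ε * ‖b‖) ^ 2 := by gcongr
  rw [norm_sub_sq_real] at h2
  -- The hypothesis reads `‖a‖² + (1 - ε²) ‖b‖² ≤ 2⟨a, b⟩`. Since `1 - ε² = (1 - ε)² + 2ε(1 - ε)`,
  -- the left side dominates `2 (1 - ε) ‖a‖ ‖b‖` by this square.
  have h3 := sq_nonneg (‖a‖ - (1 - ε) * ‖b‖)
  have h4 : 0 ≤ ε * (1 - ε) * ‖b‖ ^ 2 := by
    have := sub_nonneg.2 hε1
    positivity
  nlinarith

/-- Approximating the direction of `z` on the unit sphere to within `r` keeps the image under `R`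
at a small angle, when `r` is small compared with the condition number of `R`. -/
theorem exists_mem_cover_inner_ge {F : Type*} [NormedAddCommGroup F] [InnerProductSpace ℝ F]
    (R : E →ₗ[ℝ] F) {m M ε r : ℝ} (hε0 : 0 ≤ ε) (hε1 : ε ≤ 1) (hr : 0 ≤ r) (hM : 0 ≤ M)
    (hlow : ∀ x, m * ‖x‖ ≤ ‖R x‖) (hup : ∀ x, ‖R x‖ ≤ M * ‖x‖) (hrM : M * r ≤ ε * m)
    {C : Set E} (hC : Metric.IsCover r.toNNReal (Metric.sphere (0 : E) 1) C) (hCne : C.Nonempty)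
    (z : E) : ∃ w ∈ C, (1 - ε) * (‖R w‖ * ‖R z‖) ≤ inner ℝ (R w) (R z) := by
  rcases eq_or_ne z 0 with rfl | hz
  · obtain ⟨w, hw⟩ := hCne
    exact ⟨w, hw, by simp⟩
  have hz0 : 0 < ‖z‖ := norm_pos_iff.2 hz
  have hu : ‖‖z‖⁻¹ • z‖ = 1 := norm_smul_inv_norm hz
  obtain ⟨w, hw, hdist⟩ := hC (mem_sphere_zero_iff_norm.2 hu)
  have hdist' : ‖w - ‖z‖⁻¹ • z‖ ≤ r := by
    have : edist (‖z‖⁻¹ • z) w ≤ r.toNNReal := hdist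
    rw [edist_nndist, ENNReal.coe_le_coe, ← NNReal.coe_le_coe, Real.coe_toNNReal _ hr,
      coe_nndist, dist_comm, dist_eq_norm] at this
    exact this
  refine ⟨w, hw, ?_⟩
  have h1 : ‖R w - R (‖z‖⁻¹ • z)‖ ≤ ε * ‖R (‖z‖⁻¹ • z)‖ := by
    rw [← map_sub]
    calc _ ≤ M * ‖w - ‖z‖⁻¹ • z‖ := hup _
      _ ≤ M * r := by gcongr
      _ ≤ ε * m := hrM
      _ ≤ _ := by
        have := hlow (‖z‖⁻¹ • z)
        rw [hu, mul_one] at this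
        gcongr
  have h2 := one_sub_mul_norm_mul_norm_le_inner hε0 hε1 h1
  rw [map_smul, inner_smul_right, norm_smul, norm_inv, norm_norm] at h2
  refine le_of_mul_le_mul_left ?_ (inv_pos.2 hz0)
  linarith

end Angle

/-! ### The least squares estimate -/

section LeastSquares

variable {Ω : Type*} {d : ℕ}

theorem toLp_designMatrix_transpose_mulVec (X : ℕ → Ω → Vec d) (Y : ℕ → Ω → ℝ) (t : ℕ) (ω : Ω) :
    WithLp.toLp 2 (Matrix.mulVec (designMatrix X t ω).transpose (responseVec Y t ω))
      = ∑ s ∈ Finset.Icc 1 t, Y s ω • X s ω := by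
  ext j
  simp only [Matrix.mulVec, dotProduct, Matrix.transpose_apply, designMatrix, Matrix.of_apply,
    responseVec, WithLp.ofLp_sum, WithLp.ofLp_smul, Finset.sum_apply, Pi.smul_apply, smul_eq_mul]
  rw [Fin.sum_univ_eq_sum_range (fun k => X (k + 1) ω j * Y (k + 1) ω),
    ← Finset.Ico_add_one_right_eq_Icc, Finset.sum_Ico_eq_sum_range]
  simp [add_comm, mul_comm]

theorem toEuclideanLin_covariance (X : ℕ → Ω → Vec d) (t : ℕ) (ω : Ω) (v : Vec d) :
    Matrix.toEuclideanLin (covariance X t ω) v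
      = ∑ s ∈ Finset.Icc 1 t, (inner ℝ (X s ω) v : ℝ) • X s ω := by
  simp only [covariance, map_sum, LinearMap.sum_apply]
  refine Finset.sum_congr rfl fun s _ => ?_
  ext j
  simp [Matrix.toLpLin_apply, Matrix.vecMulVec_mulVec, PiLp.inner_apply, dotProduct, mul_comm]

/-- When `V_t ≥ ρ I`, the estimation error solves `V_t (θ̂_t - θ) = S_t`. -/
theorem covariance_apply_thetaHat_sub {X : ℕ → Ω → Vec d} {noise Y : ℕ → Ω → ℝ} {θ : Vec d}
    (hresp : ∀ t, 1 ≤ t → ∀ ω, Y t ω = inner ℝ (X t ω) θ + noise t ω) {t : ℕ} {ω : Ω}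
    (hV : (covariance X t ω).PosSemidef) {ρ : ℝ} (hρ0 : 0 < ρ)
    (hρ : (covariance X t ω - ρ • (1 : Mat d)).PosSemidef) :
    Matrix.toEuclideanLin (covariance X t ω) (thetaHat ρ X Y t ω - θ) = residual X noise t ω := by
  have h1 : Matrix.toEuclideanLin (covariance X t ω) (thetaHat ρ X Y t ω)
      = ∑ s ∈ Finset.Icc 1 t, Y s ω • X s ω := by
    rw [thetaHat, designMatrix_transpose_mul_self, clip_eq_self hV hρ, Matrix.toLpLin_apply,
      ← toLp_designMatrix_transpose_mulVec]
    simp [Matrix.mulVec_mulVec, ← Matrix.mul_assoc,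
      Matrix.mul_nonsing_inv _ (isUnit_det_of_sub_smul_one hρ0 hρ)]
  rw [map_sub, h1, toEuclideanLin_covariance, ← Finset.sum_sub_distrib, residual]
  refine Finset.sum_congr rfl fun s hs => ?_
  rw [hresp s (Finset.mem_Icc.1 hs).1, add_smul, add_sub_cancel_left]

end LeastSquares

/-! ### Covering numbers -/

section Covering

variable {d : ℕ}

theorem sphereCov_le_of_le {r s : ℝ} (hr : 0 < r) (hrs : r ≤ s) : sphereCov d s ≤ sphereCov d r :=
  ENat.toNat_le_toNat (Metric.coveringNumber_anti (Real.toNNReal_le_toNNReal hrs))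
    (coveringNumber_sphere_ne_top d hr)

theorem sphere_nonempty_of_pos (hd : 1 ≤ d) : (Metric.sphere (0 : Vec d) 1).Nonempty :=
  ⟨EuclideanSpace.single ⟨0, hd⟩ 1, by simp⟩

theorem one_le_sphereCov (hd : 1 ≤ d) {r : ℝ} (hr : 0 < r) : 1 ≤ sphereCov d r := by
  rw [Nat.one_le_iff_ne_zero, sphereCov, Ne, ENat.toNat_eq_zero, not_or]
  exact ⟨(Metric.coveringNumber_pos_iff.2 (sphere_nonempty_of_pos hd)).ne',
    coveringNumber_sphere_ne_top d hr⟩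

theorem exists_finset_cover (d : ℕ) {r : ℝ} (hr : 0 < r) :
    ∃ C : Finset (Vec d), (∀ w ∈ C, ‖w‖ = 1) ∧
      Metric.IsCover r.toNNReal (Metric.sphere (0 : Vec d) 1) (C : Set (Vec d)) ∧
      C.card = sphereCov d r := by
  obtain ⟨C, hCs, hfin, hcov, hcard⟩ :=
    Metric.exists_set_encard_eq_coveringNumber (coveringNumber_sphere_ne_top d hr)
  refine ⟨hfin.toFinset, fun w hw => ?_, by simpa using hcov, ?_⟩
  · exact mem_sphere_zero_iff_norm.1 (hCs (hfin.mem_toFinset.1 hw))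
  · rw [sphereCov, ← hcard, ← Set.ncard_def, Set.ncard_eq_toFinset_card C hfin]

end Covering

/-! ### The crossing levels of the peeling argument -/

section Peeling

variable {d : ℕ}

/-- The level used for quadratic forms of size about `α ^ k` and condition numbers of size
about `β ^ (2 * j)`. -/
def peelLevel (d : ℕ) (β ε δ : ℝ) (h : ℝ → ℝ) (k j : ℕ) : ℝ :=
  h k * (1 / δ * (1 / (1 - β⁻¹))) * (β ^ j * sphereCov d (ε / β ^ (j + 1)))

variable {α β ρ ε δ : ℝ} {h : ℝ → ℝ}

/-- A term of a nonnegative series is at most its sum. This keeps the levels above `1`, so that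
`(ψ*)⁻¹` is only evaluated at positive arguments. -/
theorem one_le_of_tsum_inv_le (h_pos : ∀ x, 0 ≤ x → 0 < h x)
    (h_summable : Summable fun k : ℕ => (h k)⁻¹) (h_sum : ∑' k : ℕ, (h k)⁻¹ ≤ 1) (k : ℕ) :
    1 ≤ h k := by
  have hk := h_pos k k.cast_nonneg
  have : (h k)⁻¹ ≤ 1 :=
    (h_summable.le_tsum k fun i _ => (inv_pos.2 (h_pos i i.cast_nonneg)).le).trans h_sum
  exact (inv_le_one₀ hk).1 this

theorem one_lt_confidenceFactor (hβ : 1 < β) (hδ : δ ∈ Set.Ioo (0 : ℝ) 1) :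
    1 < 1 / δ * (1 / (1 - β⁻¹)) := by
  have h1 : β⁻¹ < 1 := inv_lt_one_of_one_lt₀ hβ
  have h2 : 0 < β⁻¹ := by positivity
  have h3 : 1 < 1 / δ := (one_lt_div hδ.1).2 hδ.2
  have h4 : 1 < 1 / (1 - β⁻¹) := (one_lt_div (by linarith)).2 (by linarith)
  nlinarith

theorem one_lt_peelLevel (hd : 1 ≤ d) (hβ : 1 < β) (hε : 0 < ε) (hδ : δ ∈ Set.Ioo (0 : ℝ) 1)
    (hh : ∀ k : ℕ, 1 ≤ h k) (k j : ℕ) : 1 < peelLevel d β ε δ h k j := by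
  have h1 := one_lt_confidenceFactor hβ hδ
  have h2 : (1 : ℝ) ≤ β ^ j := one_le_pow₀ hβ.le
  have h3 : (1 : ℝ) ≤ sphereCov d (ε / β ^ (j + 1)) := by
    exact_mod_cast one_le_sphereCov hd (by positivity)
  exact one_lt_mul_of_lt_of_le (one_lt_mul_of_le_of_lt (hh k) h1)
    (one_le_mul_of_one_le_of_one_le h2 h3)

/-- The covering number cancels against its copy in the level, leaving `δ (1 - β⁻¹) β⁻ʲ / h k`. The
geometric series in `j` absorbs `1 - β⁻¹`, and the series in `k` is at most `1`. -/
theorem tsum_peelLevel_inv_le (hd : 1 ≤ d) (hβ : 1 < β) (hε : 0 < ε)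
    (hδ : δ ∈ Set.Ioo (0 : ℝ) 1) (h_pos : ∀ x, 0 ≤ x → 0 < h x)
    (h_summable : Summable fun k : ℕ => (h k)⁻¹) (h_sum : ∑' k : ℕ, (h k)⁻¹ ≤ 1) :
    ∑' (k : ℕ) (j : ℕ), (sphereCov d (ε / β ^ (j + 1)) : ℝ≥0∞)
      * ENNReal.ofReal (peelLevel d β ε δ h k j)⁻¹ ≤ ENNReal.ofReal δ := by
  have hb1 : β⁻¹ < 1 := inv_lt_one_of_one_lt₀ hβ
  have hb0 : 0 < β⁻¹ := by positivity
  have hhpos : ∀ k : ℕ, 0 < (h k)⁻¹ := fun k => inv_pos.2 (h_pos k k.cast_nonneg)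
  have hterm : ∀ k j : ℕ, (sphereCov d (ε / β ^ (j + 1)) : ℝ≥0∞)
      * ENNReal.ofReal (peelLevel d β ε δ h k j)⁻¹
      = ENNReal.ofReal (h k)⁻¹
        * (ENNReal.ofReal (δ * (1 - β⁻¹)) * ENNReal.ofReal (β⁻¹ ^ j)) := fun k j => by
    have hN : (0 : ℝ) < sphereCov d (ε / β ^ (j + 1)) := by
      exact_mod_cast one_le_sphereCov hd (by positivity)
    have hδ0 := hδ.1
    have hb : 0 < 1 - β⁻¹ := by linarith
    have hk := h_pos k k.cast_nonneg
    rw [← ENNReal.ofReal_natCast, ← ENNReal.ofReal_mul hN.le, ← ENNReal.ofReal_mul (by positivity),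
      ← ENNReal.ofReal_mul (hhpos k).le, peelLevel]
    congr 1
    rw [inv_pow]
    generalize 1 - β⁻¹ = c at *
    field_simp
  simp_rw [hterm, ENNReal.tsum_mul_left, ENNReal.tsum_mul_right]
  rw [← ENNReal.ofReal_tsum_of_nonneg (fun k => (hhpos k).le) h_summable,
    ← ENNReal.ofReal_tsum_of_nonneg (fun j => by positivity)
      (summable_geometric_of_lt_one hb0.le hb1), tsum_geometric_of_lt_one hb0.le hb1,
    ← ENNReal.ofReal_mul (mul_nonneg hδ.1.le (by linarith)),
    mul_inv_cancel_right₀ (by linarith)]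
  calc _ ≤ ENNReal.ofReal 1 * ENNReal.ofReal δ := by gcongr
    _ = _ := by simp

theorem log_peelLevel_le_boundaryLog (hd : 1 ≤ d) (hβ : 1 < β) (hρ : 0 < ρ)
    (hε : 0 < ε) (hδ : δ ∈ Set.Ioo (0 : ℝ) 1) (hα : 1 < α) (h_pos : ∀ x, 0 ≤ x → 0 < h x)
    (h_mono : MonotoneOn h (Set.Ici 0)) {V : Mat d} {k j : ℕ}
    (hk : ρ * α ^ k ≤ gammaMax (clip V ρ)) (hj : β ^ j ≤ √(kappa (clip V ρ))) :
    Real.log (peelLevel d β ε δ h k j) ≤ boundaryLog α β ρ ε δ h V := by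
  have hN : (0 : ℝ) < sphereCov d (ε / β ^ (j + 1)) := by
    exact_mod_cast one_le_sphereCov hd (by positivity)
  have hconf := (zero_lt_one.trans (one_lt_confidenceFactor hβ hδ)).ne'
  have hβj : (0 : ℝ) < β ^ j := by positivity
  have hsqrt : 0 < √(kappa (clip V ρ)) := hβj.trans_le hj
  have hβs : 0 < β * √(kappa (clip V ρ)) := by positivity
  rw [peelLevel, Real.log_mul (mul_ne_zero (h_pos k k.cast_nonneg).ne' hconf)
    (mul_pos hβj hN).ne', Real.log_mul (h_pos k k.cast_nonneg).ne' hconf, boundaryLog]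
  gcongr ?_ + _ + ?_
  · have hlog : (k : ℝ) ≤ Real.logb α (gammaMax (clip V ρ) / ρ) := by
      have hx : α ^ k ≤ gammaMax (clip V ρ) / ρ := by rw [le_div_iff₀ hρ]; linarith
      have hαk : 0 < α ^ k := by positivity
      rw [Real.le_logb_iff_rpow_le hα (hαk.trans_le hx)]
      simpa using hx
    exact Real.log_le_log (h_pos k k.cast_nonneg)
      (h_mono (Set.mem_Ici.2 k.cast_nonneg) (Set.mem_Ici.2 (k.cast_nonneg.trans hlog)) hlog)
  · refine Real.log_le_log (mul_pos hβj hN) ?_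
    -- Rounding `√κ` up to a power of `β` costs at most a factor `β`, hence the `β` inside the
    -- covering radius of `boundaryLog`.
    have h1 : β ^ (j + 1) ≤ β * √(kappa (clip V ρ)) := by rw [pow_succ']; gcongr
    have h2 : sphereCov d (ε / β ^ (j + 1)) ≤ sphereCov d (ε / (β * √(kappa (clip V ρ)))) :=
      sphereCov_le_of_le (by positivity) (by gcongr)
    have h3 : β ^ j ≤ β * √(kappa (clip V ρ)) :=
      hj.trans (le_mul_of_one_le_left hsqrt.le hβ.le)
    gcongr

/-- If the error `z` is at least the radius, then some projection of `V z` on a direction of the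
covers crosses its level. -/
theorem exists_peelLevel_le_exp {lamMax : EReal} {ψ : ℝ → ℝ} (hψ : IsCGFLike lamMax ψ)
    (hψ_super : IsSuperGaussian lamMax ψ) (hψ_deriv : HasUnboundedDeriv lamMax ψ)
    (hd : 1 ≤ d) (hα : 1 < α) (hβ : 1 < β) (hρ : 0 < ρ)
    (hε : ε ∈ Set.Ioo (0 : ℝ) 1) (hδ : δ ∈ Set.Ioo (0 : ℝ) 1)
    (h_pos : ∀ x, 0 ≤ x → 0 < h x) (h_mono : MonotoneOn h (Set.Ici 0))
    (hh : ∀ k : ℕ, 1 ≤ h k)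
    {C : ℕ → Finset (Vec d)} (hC1 : ∀ j, ∀ w ∈ C j, ‖w‖ = 1)
    (hC : ∀ j, Metric.IsCover (ε / β ^ (j + 1)).toNNReal (Metric.sphere (0 : Vec d) 1)
      (C j : Set (Vec d)))
    {l : ℕ → ℕ → ℝ} (hl0 : ∀ k j, 0 < l k j)
    (hl : ∀ k j, convexConjInv lamMax ψ (Real.log (peelLevel d β ε δ h k j) / (ρ * α ^ k)) * l k j
      = Real.log (peelLevel d β ε δ h k j) / (ρ * α ^ k) + ψ (l k j))
    {V : Mat d} (hV : V.PosSemidef) (hVρ : (V - ρ • (1 : Mat d)).PosSemidef) {z : Vec d}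
    (hz : radius lamMax ψ α β ρ ε δ h V ≤ ‖Matrix.toEuclideanLin (sqrtMat V) z‖) :
    ∃ k j, ∃ w ∈ C j, peelLevel d β ε δ h k j
      ≤ Real.exp (l k j * inner ℝ w (Matrix.toEuclideanLin V z)
        - ψ (l k j) * inner ℝ w (Matrix.toEuclideanLin V w)) := by
  set R := Matrix.toEuclideanLin (sqrtMat V) with hR
  have hclip := clip_eq_self hV hVρ
  have hρg : ρ ≤ gammaMin V := le_gammaMin hd hV hVρ
  have hg : 0 < gammaMin V := hρ.trans_le hρg
  have hform : ∀ x : Vec d, ‖x‖ = 1 → gammaMin V ≤ ‖R x‖ ^ 2 ∧ ‖R x‖ ^ 2 ≤ gammaMax V :=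
    fun x hx => by
      rw [norm_sqrtMat_sq hV]
      exact ⟨by simpa [hx] using gammaMin_mul_norm_sq_le hV x,
        by simpa [hx] using inner_le_gammaMax_mul_norm_sq hV x⟩
  have hgG : gammaMin V ≤ gammaMax V := by
    obtain ⟨x, hx⟩ := sphere_nonempty_of_pos hd
    have := hform x (mem_sphere_zero_iff_norm.1 hx)
    exact this.1.trans this.2
  have hG : 0 < gammaMax V := hg.trans_le hgG
  have hκ1 : 1 ≤ √(kappa V) := Real.one_le_sqrt.2 ((one_le_div hg).2 hgG)
  -- The condition-number cell: `β ^ j ≤ √κ < β ^ (j + 1)`. The upper bound makes the cover fine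
  -- enough, the lower one keeps the level below the boundary.
  obtain ⟨j, hj, hj'⟩ := exists_nat_pow_near hκ1 hβ
  have hκ : √(gammaMax V) = √(kappa V) * √(gammaMin V) := by
    rw [← Real.sqrt_mul (by positivity [div_pos hG hg]), kappa, div_mul_cancel₀ _ hg.ne']
  obtain ⟨w, hw, hwz⟩ := exists_mem_cover_inner_ge R (m := √(gammaMin V)) (M := √(gammaMax V))
    hε.1.le hε.2.le (r := ε / β ^ (j + 1)) (by have := hε.1; positivity) (Real.sqrt_nonneg _)
    (fun x => by
      refine le_of_sq_le_sq ?_ (norm_nonneg _)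
      rw [mul_pow, Real.sq_sqrt hg.le, norm_sqrtMat_sq hV]
      exact gammaMin_mul_norm_sq_le hV x)
    (fun x => by
      refine le_of_sq_le_sq ?_ (by positivity)
      rw [mul_pow, Real.sq_sqrt hG.le, norm_sqrtMat_sq hV]
      exact inner_le_gammaMax_mul_norm_sq hV x)
    (by
      rw [hκ, mul_div_assoc', div_le_iff₀ (by positivity)]
      have := hε.1
      have : √(kappa V) * (√(gammaMin V) * ε) ≤ β ^ (j + 1) * (√(gammaMin V) * ε) := by gcongr
      linarith)
    (hC j) ((hC j).nonempty (sphere_nonempty_of_pos hd)) z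
  obtain ⟨hgW, hWG⟩ := hform w (hC1 j w hw)
  set W := ‖R w‖ ^ 2 with hWdef
  have hW0 : 0 < W := hg.trans_le hgW
  -- The shell is that of `W`, the form in the chosen direction, not of an eigenvalue; `W ≤ gammaMax
  -- V` still bounds `k` by the logarithm in `boundaryLog`.
  obtain ⟨k, hk, hk'⟩ := exists_nat_pow_near ((one_le_div hρ).2 (hρg.trans hgW)) hα
  rw [le_div_iff₀ hρ] at hk
  rw [div_lt_iff₀ hρ] at hk'
  refine ⟨k, j, w, hw, ?_⟩
  set H := peelLevel d β ε δ h k j with hH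
  have hH1 : 1 < H := one_lt_peelLevel hd hβ hε.1 hδ hh k j
  have hlogH : 0 < Real.log H := Real.log_pos hH1
  set B := boundaryLog α β ρ ε δ h V with hB
  have hHB : Real.log H ≤ B :=
    log_peelLevel_le_boundaryLog hd hβ hρ hε.1 hδ hα h_pos h_mono
      (by rw [hclip]; linarith) (by rwa [hclip])
  have hv : 0 < ρ * α ^ k := by positivity
  set u := convexConjInv lamMax ψ (Real.log H / (ρ * α ^ k)) with hu
  -- The factor `α` in the radius pays for tuning at `ρ * α ^ k` instead of at `W < ρ * α ^ (k +
  -- 1)`.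
  have hu1 : u ≤ convexConjInv lamMax ψ (α * B / W) := by
    refine hψ.convexConjInv_mono hψ_deriv (div_pos hlogH hv) ?_
    rw [div_le_div_iff₀ hv hW0]
    have : W ≤ α * (ρ * α ^ k) := by rw [pow_succ] at hk'; linarith
    calc Real.log H * W ≤ B * (α * (ρ * α ^ k)) := by
          gcongr
          exact hlogH.le.trans hHB
      _ = _ := by ring
  have hu2 := hψ.sqrt_mul_convexConjInv_anti hψ_super hψ_deriv
    (c := α * B) (mul_pos (by linarith) (hlogH.trans_le hHB)) hg hgW
  have hsW : √W = ‖R w‖ := Real.sqrt_sq (norm_nonneg _)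
  have hz' : √(gammaMin V) * convexConjInv lamMax ψ (α * B / gammaMin V) ≤ (1 - ε) * ‖R z‖ := by
    have hε1 : 0 < 1 - ε := by linarith [hε.2]
    rw [radius, div_mul_eq_mul_div α, div_mul_eq_mul_div, div_le_iff₀ hε1] at hz
    linarith
  have hcross : W * u ≤ inner ℝ w (Matrix.toEuclideanLin V z) := by
    rw [← inner_sqrtMat_sqrtMat hV]
    calc W * u = ‖R w‖ * (√W * u) := by rw [hsW, hWdef]; ring
      _ ≤ ‖R w‖ * ((1 - ε) * ‖R z‖) := by
        refine mul_le_mul_of_nonneg_left ?_ (norm_nonneg _)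
        exact (mul_le_mul_of_nonneg_left hu1 (Real.sqrt_nonneg _)).trans (hu2.trans hz')
      _ ≤ _ := by linarith
  rw [← Real.log_le_iff_le_exp (by linarith), ← norm_sqrtMat_sq hV, ← hR, ← hWdef]
  -- Optimality of `l k j` splits the linear term into `W * ψ (l k j)`, cancelled by the variance
  -- compensator, and a rest that is at least `Real.log H` because `W ≥ ρ * α ^ k`.
  have h1 : l k j * (W * u) = W * (Real.log H / (ρ * α ^ k)) + W * ψ (l k j) := by
    rw [← mul_add, ← hl k j]; ring
  have h2 : l k j * (W * u) ≤ l k j * inner ℝ w (Matrix.toEuclideanLin V z) :=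
    mul_le_mul_of_nonneg_left hcross (hl0 k j).le
  have h3 : Real.log H ≤ W * (Real.log H / (ρ * α ^ k)) := by
    rw [mul_div_assoc', le_div_iff₀ hv, mul_comm]
    gcongr
    linarith
  linarith

end Peeling

/-- The line-crossing bound for a scalar sub-`ψ` process. -/
theorem IsSubPsiScalar.measure_exists_le_exp {Ω : Type*} {mΩ : MeasurableSpace Ω} {μ : Measure Ω}
    [IsFiniteMeasure μ] {ℱ : Filtration ℕ mΩ} {lamMax : EReal} {ψ : ℝ → ℝ} {S V : ℕ → Ω → ℝ}
    (hS : IsSubPsiScalar μ ℱ lamMax ψ S V) {l : ℝ} (hl : l ∈ dom lamMax) {c : ℝ} (hc : 0 < c) :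
    μ {ω | ∃ t, c ≤ Real.exp (l * S t ω - ψ l * V t ω)} ≤ ENNReal.ofReal c⁻¹ := by
  obtain ⟨L, hL, hnonneg, hinit, hdom⟩ := hS.exists_supermartingale l hl
  refine le_trans (measure_mono_ae ?_) (measure_exists_le_of_supermartingale hL hnonneg hinit hc)
  filter_upwards [hdom] with ω hω ⟨t, ht⟩
  exact ⟨t, ht.trans (hω t)⟩

end

end OnlineReg

/-! ### The union bound over cells and directions -/

open OnlineReg

theorem corollary5p1 {Ω : Type*} {mΩ : MeasurableSpace Ω}
    (μ : MeasureTheory.Measure Ω) [MeasureTheory.IsProbabilityMeasure μ]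
    (ℱ : MeasureTheory.Filtration ℕ mΩ) (d : ℕ) (hd : 1 ≤ d)
    -- a super-Gaussian CGF-like function with `sup ψ' = ∞`
    (lamMax : EReal) (ψ : ℝ → ℝ) (hψ : OnlineReg.IsCGFLike lamMax ψ)
    (hψ_super : OnlineReg.IsSuperGaussian lamMax ψ)
    (hψ_deriv : OnlineReg.HasUnboundedDeriv lamMax ψ)
    -- the regression model
    (θ : OnlineReg.Vec d) (X : ℕ → Ω → OnlineReg.Vec d) (noise Y : ℕ → Ω → ℝ)
    (hmodel : OnlineReg.IsOnlineLinReg μ ℱ lamMax ψ θ X noise Y)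
    -- the parameters
    (α β ρ ε δ : ℝ) (hα : 1 < α) (hβ : 1 < β) (hρ : 0 < ρ)
    (hε : ε ∈ Set.Ioo (0 : ℝ) 1) (hδ : δ ∈ Set.Ioo (0 : ℝ) 1)
    (h : ℝ → ℝ) (h_pos : ∀ x, 0 ≤ x → 0 < h x) (h_mono : MonotoneOn h (Set.Ici 0))
    (h_summable : Summable fun k : ℕ => (h k)⁻¹) (h_sum : ∑' k : ℕ, (h k)⁻¹ ≤ 1) :
    μ {ω | ∃ t : ℕ,
        OnlineReg.radius lamMax ψ α β ρ ε δ h (OnlineReg.covariance X t ω) ≤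
          ‖Matrix.toEuclideanLin (OnlineReg.sqrtMat (OnlineReg.covariance X t ω))
            (OnlineReg.thetaHat ρ X Y t ω - θ)‖ ∧
        (OnlineReg.covariance X t ω - ρ • (1 : OnlineReg.Mat d)).PosSemidef}
      ≤ ENNReal.ofReal δ := by
  have hh := one_le_of_tsum_inv_le h_pos h_summable h_sum
  have hlevel := one_lt_peelLevel (d := d) hd hβ hε.1 hδ hh
  have hcov : ∀ j : ℕ, _ := fun j : ℕ => exists_finset_cover d (r := ε / β ^ (j + 1))
    (div_pos hε.1 (pow_pos (by linarith) _))
  choose C hC1 hC hCcard using hcov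
  -- The tuning `l k j` depends on the cell alone, not on the outcome, so each crossing event
  -- concerns a single supermartingale.
  have hopt : ∀ k j : ℕ, _ := fun k j : ℕ => (hψ.convexConjInv_spec hψ_deriv
    (x := Real.log (peelLevel d β ε δ h k j) / (ρ * α ^ k))
    (div_pos (Real.log_pos (hlevel k j)) (mul_pos hρ (pow_pos (by linarith) _)))).1
  choose l hl hl0 hlx using hopt
  have hV := hmodel.subPsi.posSemidef_V
  calc _ ≤ μ (⋃ k : ℕ, ⋃ j : ℕ, ⋃ w ∈ C j, {ω | ∃ t, peelLevel d β ε δ h k j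
          ≤ Real.exp (l k j * inner ℝ w (residual X noise t ω)
            - ψ (l k j) * inner ℝ w (Matrix.toEuclideanLin (covariance X t ω) w))}) := by
        refine measure_mono ?_
        rintro ω ⟨t, hrad, hVρ⟩
        obtain ⟨k, j, w, hw, hcross⟩ := exists_peelLevel_le_exp hψ hψ_super hψ_deriv hd hα hβ hρ
          hε hδ h_pos h_mono hh hC1 hC hl0 hlx (hV t ω) hVρ hrad
        -- Here `V z = S`: the crossing becomes one of the residual process, and `θ` disappears.
        rw [covariance_apply_thetaHat_sub hmodel.response (hV t ω) hρ hVρ] at hcross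
        exact Set.mem_iUnion.2 ⟨k, Set.mem_iUnion.2 ⟨j, Set.mem_iUnion₂.2 ⟨w, hw, t, hcross⟩⟩⟩
    _ ≤ ∑' (k : ℕ) (j : ℕ), ∑ w ∈ C j, ENNReal.ofReal (peelLevel d β ε δ h k j)⁻¹ := by
        refine (measure_iUnion_le _).trans (ENNReal.tsum_le_tsum fun k => ?_)
        refine (measure_iUnion_le _).trans (ENNReal.tsum_le_tsum fun j => ?_)
        refine (measure_biUnion_finset_le _ _).trans (Finset.sum_le_sum fun w hw => ?_)
        exact (hmodel.subPsi.subPsi_proj w (hC1 j w hw)).measure_exists_le_exp (hl k j)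
          (zero_lt_one.trans (hlevel k j))
    _ ≤ ENNReal.ofReal δ := by
        simp_rw [Finset.sum_const, nsmul_eq_mul, hCcard]
        exact tsum_peelLevel_inv_le hd hβ hε.1 hδ h_pos h_summable h_sum
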